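/- Let $S$ be a connected closed surface, $V\subset S$ a finite set, and $\mathcal T=(V,E,F)$ a triangulation of $(S,V)$ (finitely many triangles whose sides are glued together; loops and multiple edges are allowed). A PH (piecewise hyperbolic) metric on $(S,V,\mathcal T)$ is a map $d:E\to(0,\infty)$ whose values on the three sides of every face satisfy the strict triangle inequalities, so that every face becomes a hyperbolic triangle. Its classical combinatorial curvature at $v_i\in V$ is $K_i=2\pi-\sum\theta$, where $\theta$ runs over the inner angles at all corners of faces located at $v_i$. For $u:V\to\mathbb R$, the vertex scaling $u*d$ is given by $$\sinh\frac{(u*d)_{ij}}2=e^{u_i+u_j}\sinh\frac{d_{ij}}2\qquad\text{for every edge } v_iv_j\in E .$$ The admissible space $\mathcal U(d)\subset\mathbb R^V$ is the set of all $u$ for which $u*d$ is again a PH metric, i.e. satisfies the strict triangle inequalities in every face; its elements are called discrete conformal factors for $d$. For $\alpha\in\mathbb R$ and $u\in\mathcal U(d)$, the combinatorial $\alpha$-curvature of $u*d$ is $R_{\alpha,i}=K_i(u*d)/e^{\alpha u_i}$. For arbitrary $u\in\mathbb R^V$, the extended inner angles of a face are its inner angles in $u*d$ if the strict triangle inequalities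 hold there; if one side of the face is at least as long as the sum of the two others, the extended angle opposite to that side is $\pi$ and the two others are $0$ (these are continuous functions of $u$). Let $\widetilde K_i$ be the curvature formed with the extended angles and $\widetilde R_{\alpha,i}(u)=\widetilde K_i(u)/e^{\alpha u_i}$ the extended combinatorial $\alpha$-curvature. Theorem. Let $d_0$ be a PH metric on $(S,V,\mathcal T)$, $\alpha\in\mathbb R$ and $\overline R:V\to\mathbb R$ with $\alpha\overline R_i\le 0$ for all $v_i\in V$. (1) There is at most one discrete conformal factor $u\in\mathcal U(d_0)$ such that the combinatorial $\alpha$-curvature of $u*d_0$ is $\overline R$. (2) If $u_A\in\mathcal U(d_0)$ and $u_B\in\mathbb R^V$ satisfy $\widetilde R_\alpha(u_A)=\widetilde R_\alpha(u_B)=\overline R$, then $u_A=u_B$. -/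

import Mathlib

/-- The open simplex with vertex set `Fin n`: all barycentric coordinates are positive. -/
abbrev OpenSimplex (n : ℕ) : Type :=
  {x : stdSimplex ℝ (Fin n) // ∀ i, 0 < x i}

/-- A (finite) triangulation `𝒯 = (V, E, F)` of a marked surface `(S, V)`, given by
characteristic maps of its edges and faces.  Every side of a face is glued affinely onto an
edge, and `S` is the disjoint union of `V`, the open edges and the open faces, each of which
is embedded by its characteristic map.  Several vertices of a face may coincide,
loops and multiple edges are allowed, so that this covers both simplicial
complexes and the general triangulations of marked surfaces. -/
structure Triangulation (S : Type*) [TopologicalSpace S] (V : Finset S) where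
  /-- the set `E` of edges -/
  Edge : Type
  /-- the set `F` of faces -/
  Face : Type
  [fintypeEdge : Fintype Edge]
  [fintypeFace : Fintype Face]
  /-- the characteristic map of an edge -/
  edgeMap : Edge → C(stdSimplex ℝ (Fin 2), S)
  /-- the characteristic map of a face -/
  faceMap : Face → C(stdSimplex ℝ (Fin 3), S)
  edgeMap_vertex_mem : ∀ e i, edgeMap e (stdSimplex.vertex i) ∈ V
  faceMap_vertex_mem : ∀ f i, faceMap f (stdSimplex.vertex i) ∈ V
  /-- `side f i` is the edge onto which the side of `f` opposite to the corner `i` is glued -/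
  side : Face → Fin 3 → Edge
  /-- the side of `f` opposite to the corner `i` is the edge `side f i`, with one of its two
  orientations -/
  faceMap_side : ∀ f i, ∃ π : Equiv.Perm (Fin 2), ∀ x : stdSimplex ℝ (Fin 2),
    faceMap f (stdSimplex.map i.succAbove x) = edgeMap (side f i) (stdSimplex.map π x)
  /-- `S` is the disjoint union of the vertices, the open edges and the open faces -/
  bijective_cells : Function.Bijective
    (Sum.elim (fun v : V => (v : S))
      (Sum.elim (fun p : Edge × OpenSimplex 2 => edgeMap p.1 p.2.1)
        (fun p : Face × OpenSimplex 3 => faceMap p.1 p.2.1)))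
  /-- every vertex is a corner of a face -/
  exists_corner : ∀ v ∈ V, ∃ f i, faceMap f (stdSimplex.vertex i) = v
  /-- every edge is a side of a face -/
  exists_side : ∀ e, ∃ f i, side f i = e

/-- The inner angle, opposite to the side of length `a`, of the hyperbolic triangle with side
lengths `a`, `b`, `c` (which satisfy the strict triangle inequalities), as given by the
hyperbolic law of cosines `cosh a = cosh b * cosh c - sinh b * sinh c * cos θ`. -/
noncomputable def hypAngle (a b c : ℝ) : ℝ :=
  Real.arccos ((Real.cosh b * Real.cosh c - Real.cosh a) / (Real.sinh b * Real.sinh c))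

/-- The extension of `hypAngle` by constants to all triples of positive reals: if a triangle
inequality fails, the angle opposite to the too long side is `π`, the two others are `0`. -/
noncomputable def extHypAngle (a b c : ℝ) : ℝ :=
  if b + c ≤ a then Real.pi
  else if c + a ≤ b ∨ a + b ≤ c then 0
  else hypAngle a b c

theorem extHypAngle_eq_hypAngle {a b c : ℝ} (ha : 0 < a) (hb : 0 < b) (hc : 0 < c) :
    extHypAngle a b c = hypAngle a b c := by
  have hs : 0 < Real.sinh b * Real.sinh c :=
    mul_pos (Real.sinh_pos_iff.2 hb) (Real.sinh_pos_iff.2 hc)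
  unfold extHypAngle
  split_ifs with h1 h2
  · have h : Real.cosh (b + c) ≤ Real.cosh a :=
      Real.cosh_le_cosh.2 (by rwa [abs_of_pos (by linarith), abs_of_pos ha])
    rw [Real.cosh_add] at h
    exact (Real.arccos_of_le_neg_one (by rw [div_le_iff₀ hs]; linarith)).symm
  · have h : Real.cosh a ≤ Real.cosh (b - c) := by
      rw [Real.cosh_le_cosh, abs_of_pos ha]
      rcases h2 with h | h
      · exact le_trans (by linarith) (le_abs_self _)
      · exact le_trans (by linarith) (neg_le_abs _)
    rw [Real.cosh_sub] at h
    exact (Real.arccos_of_one_le (by rw [le_div_iff₀ hs]; linarith)).symm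
  · rfl

namespace Triangulation

variable {S : Type*} [TopologicalSpace S] {V : Finset S}

attribute [instance] Triangulation.fintypeEdge Triangulation.fintypeFace

/-- The `i`-th end point of an edge. -/
def endpoint (T : Triangulation S V) (e : T.Edge) (i : Fin 2) : V :=
  ⟨T.edgeMap e (stdSimplex.vertex i), T.edgeMap_vertex_mem e i⟩

/-- The vertex at the `i`-th corner of a face. -/
def corner (T : Triangulation S V) (f : T.Face) (i : Fin 3) : V :=
  ⟨T.faceMap f (stdSimplex.vertex i), T.faceMap_vertex_mem f i⟩

open scoped Classical in
/-- The sum of the values `θ f i` over all corners `(f, i)` of faces that lie at `v`. -/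
noncomputable def cornerSum (T : Triangulation S V) (θ : T.Face → Fin 3 → ℝ) (v : V) : ℝ :=
  ∑ f : T.Face, ∑ i : Fin 3, if T.corner f i = v then θ f i else 0

/-- A PH metric on a triangulated surface: positive edge lengths that satisfy the strict
triangle inequalities in every face. -/
structure PHMetric (T : Triangulation S V) where
  length : T.Edge → ℝ
  length_pos : ∀ e, 0 < length e
  triangle_lt : ∀ f i,
    length (T.side f i) < length (T.side f (i + 1)) + length (T.side f (i + 2))

namespace PHMetric

variable {T : Triangulation S V}

/-- The inner angle at the corner `i` of the face `f`. -/
noncomputable def angle (d : T.PHMetric) (f : T.Face) (i : Fin 3) : ℝ :=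
  hypAngle (d.length (T.side f i)) (d.length (T.side f (i + 1))) (d.length (T.side f (i + 2)))

/-- The classical combinatorial curvature `K`. -/
noncomputable def curvature (d : T.PHMetric) (v : V) : ℝ :=
  2 * Real.pi - T.cornerSum d.angle v

/-- The edge lengths of the vertex scaling `u * d`. -/
noncomputable def scaledLength (d : T.PHMetric) (u : V → ℝ) (e : T.Edge) : ℝ :=
  2 * Real.arsinh
    (Real.sinh (d.length e / 2) * Real.exp (u (T.endpoint e 0) + u (T.endpoint e 1)))

theorem sinh_scaledLength (d : T.PHMetric) (u : V → ℝ) (e : T.Edge) :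
    Real.sinh (d.scaledLength u e / 2) =
      Real.sinh (d.length e / 2) * Real.exp (u (T.endpoint e 0) + u (T.endpoint e 1)) := by
  simp [scaledLength, mul_div_cancel_left₀]

theorem scaledLength_pos (d : T.PHMetric) (u : V → ℝ) (e : T.Edge) :
    0 < d.scaledLength u e := by
  have h := d.length_pos e
  have h' : 0 < Real.sinh (d.length e / 2) := Real.sinh_pos_iff.2 (by linarith)
  exact mul_pos two_pos (Real.arsinh_pos_iff.2 (mul_pos h' (Real.exp_pos _)))

/-- The admissible space of `d`: all `u` for which the lengths of `u * d` satisfy the strict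
triangle inequalities in every face. -/
def admissibleSpace (d : T.PHMetric) : Set (V → ℝ) :=
  {u | ∀ f i, d.scaledLength u (T.side f i) <
    d.scaledLength u (T.side f (i + 1)) + d.scaledLength u (T.side f (i + 2))}

/-- The vertex scaling `u * d`, a PH metric, by an admissible `u`. -/
noncomputable def scale (d : T.PHMetric) (u : d.admissibleSpace) : T.PHMetric where
  length := d.scaledLength u
  length_pos := d.scaledLength_pos u
  triangle_lt := u.2

/-- The combinatorial `α`-curvature of `u * d`, with `u` a discrete conformal factor for `d`. -/
noncomputable def alphaCurvature (d : T.PHMetric) (α : ℝ) (u : d.admissibleSpace) (v : V) : ℝ :=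
  (d.scale u).curvature v / Real.exp (u.1 v) ^ α

/-- The extended inner angle of `u * d` at the corner `i` of the face `f`, for arbitrary `u`. -/
noncomputable def extAngle (d : T.PHMetric) (u : V → ℝ) (f : T.Face) (i : Fin 3) : ℝ :=
  extHypAngle (d.scaledLength u (T.side f i)) (d.scaledLength u (T.side f (i + 1)))
    (d.scaledLength u (T.side f (i + 2)))

/-- `extAngle` extends the inner angles of `u * d` from the admissible space. -/
theorem extAngle_eq_angle (d : T.PHMetric) (u : d.admissibleSpace) :
    d.extAngle u.1 = (d.scale u).angle := by
  funext f i
  exact extHypAngle_eq_hypAngle (d.scaledLength_pos _ _) (d.scaledLength_pos _ _)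
    (d.scaledLength_pos _ _)

/-- The extended inner angles are continuous. -/
theorem continuous_extAngle (d : T.PHMetric) (f : T.Face) (i : Fin 3) :
    Continuous fun u => d.extAngle u f i := by
  have h : ∀ e, Continuous fun u => d.scaledLength u e := fun e => by
    unfold scaledLength
    exact continuous_const.mul (Real.continuous_arsinh.comp (by fun_prop))
  have h0 : ∀ e u, Real.sinh (d.scaledLength u e) ≠ 0 := fun e u =>
    (Real.sinh_pos_iff.2 (d.scaledLength_pos u e)).ne'
  have h1 : (fun u => d.extAngle u f i) = fun u => hypAngle (d.scaledLength u (T.side f i))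
      (d.scaledLength u (T.side f (i + 1))) (d.scaledLength u (T.side f (i + 2))) :=
    funext fun u => extHypAngle_eq_hypAngle (d.scaledLength_pos _ _)
      (d.scaledLength_pos _ _) (d.scaledLength_pos _ _)
  rw [h1]
  unfold hypAngle
  refine Real.continuous_arccos.comp (Continuous.div ?_ ?_ fun u => mul_ne_zero (h0 _ _) (h0 _ _))
  · exact ((Real.continuous_cosh.comp (h _)).mul (Real.continuous_cosh.comp (h _))).sub
      (Real.continuous_cosh.comp (h _))
  · exact (Real.continuous_sinh.comp (h _)).mul (Real.continuous_sinh.comp (h _))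

/-- The extended combinatorial curvature. -/
noncomputable def extCurvature (d : T.PHMetric) (u : V → ℝ) (v : V) : ℝ :=
  2 * Real.pi - T.cornerSum (d.extAngle u) v

/-- The extended combinatorial `α`-curvature. -/
noncomputable def extAlphaCurvature (d : T.PHMetric) (α : ℝ) (u : V → ℝ) (v : V) : ℝ :=
  d.extCurvature u v / Real.exp (u v) ^ α

end PHMetric

end Triangulation

/-!
Write `K` for the extended curvature. It is strictly monotone at admissible conformal factors,
`0 < ∑ v, (K u' v - K u v) * (u' v - u v)`, while `α * R v ≤ 0` makes `x ↦ R v * exp (α * x)`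
antitone. Hence `K u v = R v * exp (α * u v)` has no second solution next to an admissible one.

The monotonicity of `K` is a sum of contributions of the faces. Along a line `u + s • h`, consider
the pairing `∑ i, θ i * h i` of the extended angles of one face with `h`. Where the triangle
inequalities hold, its derivative is the negative of a positive definite quadratic form; where they
fail, all the angles are `0` or `π`, so that the pairing lies in a finite set. A continuous function
can only cross the values outside that set downwards, so the pairing is antitone. This replaces the
extension of a concave energy function across the degenerate triangles.
-/

section RealLine

open Filter Set Topology

theorem eventually_lt_of_hasDerivWithinAt_neg {g : ℝ → ℝ} {g' t : ℝ}
    (hd : HasDerivWithinAt g g' (Ioi t) t) (hg' : g' < 0) : ∀ᶠ x in 𝓝[>] t, g x < g t := by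
  filter_upwards [hd.limsup_slope_le' self_notMem_Ioi hg', self_mem_nhdsWithin] with x hslope hx
  rw [slope_def_field, div_lt_iff₀ (sub_pos.2 hx), zero_mul, sub_neg] at hslope
  exact hslope

theorem antitone_of_hasDerivWithinAt_neg_or_mem {g : ℝ → ℝ} (hg : Continuous g) {Z : Set ℝ}
    (hZ : Dense Zᶜ) (h : ∀ t, g t ∈ Z ∨ ∃ g' < 0, HasDerivWithinAt g g' (Ioi t) t) :
    Antitone g := by
  intro s t hst
  by_contra! hlt
  obtain ⟨y, hyZ, hsy, hyt⟩ := hZ.exists_between hlt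
  have hclosed : IsClosed ({x | g x ≤ y} ∩ Icc s t) :=
    (isClosed_le hg continuous_const).inter isClosed_Icc
  have hle : Icc s t ⊆ {x | g x ≤ y} := by
    refine hclosed.Icc_subset_of_forall_mem_nhdsWithin hsy.le ?_
    rintro x ⟨hxy : g x ≤ y, -⟩
    rcases hxy.lt_or_eq with hxy | rfl
    · exact nhdsWithin_le_nhds ((hg.tendsto x).eventually (ge_mem_nhds hxy))
    · obtain ⟨g', hg', hd⟩ := (h x).resolve_left hyZ
      exact (eventually_lt_of_hasDerivWithinAt_neg hd hg').mono fun _ => le_of_lt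
  exact (hle ⟨hst, le_rfl⟩).not_gt hyt

theorem lt_of_antitone_of_hasDerivWithinAt_neg {g : ℝ → ℝ} {g' s t : ℝ} (hg : Antitone g)
    (hd : HasDerivWithinAt g g' (Ioi s) s) (hg' : g' < 0) (hst : s < t) : g t < g s := by
  obtain ⟨x, hlt, hx⟩ :=
    ((eventually_lt_of_hasDerivWithinAt_neg hd hg').and (Ioo_mem_nhdsGT hst)).exists
  exact (hg hx.2.le).trans_lt hlt

theorem antitone_const_mul_exp {α r : ℝ} (h : α * r ≤ 0) :
    Antitone fun x => r * Real.exp (α * x) := by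
  have hd (x : ℝ) : HasDerivAt (fun x => r * Real.exp (α * x)) (α * r * Real.exp (α * x)) x :=
    (((hasDerivAt_id' x).const_mul α).exp.const_mul r).congr_deriv (by ring)
  exact antitone_of_hasDerivAt_nonpos hd fun x =>
    mul_nonpos_of_nonpos_of_nonneg h (Real.exp_pos _).le

end RealLine

theorem quadratic_form_pos_of_minors_pos {K : Type*} [CommRing K] [LinearOrder K]
    [IsStrictOrderedRing K] {a b c p q r : K} (ha : 0 < a) (hab : 0 < a * b - p ^ 2)
    (hdet : 0 < a * b * c + 2 * p * q * r - a * r ^ 2 - b * q ^ 2 - c * p ^ 2)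
    {x y z : K} (h : x ≠ 0 ∨ y ≠ 0 ∨ z ≠ 0) :
    0 < a * x ^ 2 + b * y ^ 2 + c * z ^ 2 + 2 * p * x * y + 2 * q * x * z + 2 * r * y * z := by
  have complete_squares : a * (a * b - p ^ 2) *
      (a * x ^ 2 + b * y ^ 2 + c * z ^ 2 + 2 * p * x * y + 2 * q * x * z + 2 * r * y * z) =
      (a * b - p ^ 2) * (a * x + p * y + q * z) ^ 2 +
      ((a * b - p ^ 2) * y + (a * r - p * q) * z) ^ 2 +
      a * (a * b * c + 2 * p * q * r - a * r ^ 2 - b * q ^ 2 - c * p ^ 2) * z ^ 2 := by ring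
  refine pos_of_mul_pos_right (a := a * (a * b - p ^ 2)) ?_ (by positivity)
  rw [complete_squares]
  rcases ne_or_eq z 0 with hz | rfl
  · positivity
  rcases ne_or_eq y 0 with hy | rfl
  · simp only [mul_zero, add_zero, ne_eq, OfNat.ofNat_ne_zero, not_false_eq_true, zero_pow]
    positivity
  · have hx : x ≠ 0 := by simpa using h
    simp only [mul_zero, add_zero, ne_eq, OfNat.ofNat_ne_zero, not_false_eq_true, zero_pow]
    positivity

section Gram

/-- The Gram determinant, up to sign, of three unit timelike vectors with pairwise Lorentzian inner
products `-A`, `-B`, `-C`. When these are the hyperbolic cosines of three side lengths, it is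
positive exactly for the side lengths of a nondegenerate hyperbolic triangle. -/
def gramDet (A B C : ℝ) : ℝ :=
  1 + 2 * A * B * C - A ^ 2 - B ^ 2 - C ^ 2

theorem gramDet_rotate (A B C : ℝ) : gramDet B C A = gramDet A B C := by
  unfold gramDet
  ring

theorem gramDet_cosh (a b c : ℝ) :
    gramDet (Real.cosh a) (Real.cosh b) (Real.cosh c) = (Real.sinh b * Real.sinh c) ^ 2 -
      (Real.cosh b * Real.cosh c - Real.cosh a) ^ 2 := by
  rw [gramDet, mul_pow, Real.sinh_sq, Real.sinh_sq]
  ring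

theorem gramDet_cosh_pos {a b c : ℝ} (ha : a < b + c) (hb : b < c + a) (hc : c < a + b) :
    0 < gramDet (Real.cosh a) (Real.cosh b) (Real.cosh c) := by
  have hb₀ : 0 < b := by linarith
  have hc₀ : 0 < c := by linarith
  have h_lt : Real.cosh a < Real.cosh (b + c) :=
    Real.cosh_lt_cosh.2 (by rwa [abs_of_pos (by linarith), abs_of_pos (by linarith)])
  have h_gt : Real.cosh (b - c) < Real.cosh a := by
    rw [Real.cosh_lt_cosh, abs_of_pos (show 0 < a by linarith), abs_lt]
    constructor <;> linarith
  rw [Real.cosh_add] at h_lt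
  rw [Real.cosh_sub] at h_gt
  have hs : 0 < Real.sinh b * Real.sinh c :=
    mul_pos (Real.sinh_pos_iff.2 hb₀) (Real.sinh_pos_iff.2 hc₀)
  rw [gramDet_cosh, sub_pos, sq_lt_sq, abs_of_pos hs, abs_lt]
  constructor <;> linarith

/-- The quadratic form by which the angles of a hyperbolic triangle decrease under vertex scaling.
Here `A`, `B`, `C` are the hyperbolic cosines of the sides, and `x`, `y`, `z` are the velocities of
the logarithms of `sinh (a / 2)`, `sinh (b / 2)`, `sinh (c / 2)`. -/
noncomputable def scalingForm (A B C x y z : ℝ) : ℝ :=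
  (1 + A + B + C) *
    ((A - 1) / (A + 1) * x ^ 2 + (B - 1) / (B + 1) * y ^ 2 + (C - 1) / (C + 1) * z ^ 2) -
  2 * ((A + B - C - 1) * x * y + (B + C - A - 1) * y * z + (C + A - B - 1) * z * x)

theorem scalingForm_pos {A B C : ℝ} (hA : 1 < A) (hB : 1 < B) (hC : 1 < C)
    (hG : 0 < gramDet A B C) {x y z : ℝ} (h : x ≠ 0 ∨ y ≠ 0 ∨ z ≠ 0) :
    0 < scalingForm A B C x y z := by
  have : 0 < A - 1 := sub_pos.2 hA
  -- The minors factor because `(1 + A + B + C) ^ 2 = 2 * (A + 1) * (B + 1) * (C + 1) - G`, with `G`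
  -- the Gram determinant.
  have minor_two : (1 + A + B + C) * ((A - 1) / (A + 1)) * ((1 + A + B + C) * ((B - 1) / (B + 1))) -
      (-(A + B - C - 1)) ^ 2 = 2 * gramDet A B C * (A + B) / ((A + 1) * (B + 1)) := by
    unfold gramDet
    field_simp
    ring
  have minor_three : (1 + A + B + C) * ((A - 1) / (A + 1)) *
      ((1 + A + B + C) * ((B - 1) / (B + 1))) * ((1 + A + B + C) * ((C - 1) / (C + 1))) +
      2 * -(A + B - C - 1) * -(C + A - B - 1) * -(B + C - A - 1) -
      (1 + A + B + C) * ((A - 1) / (A + 1)) * (-(B + C - A - 1)) ^ 2 -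
      (1 + A + B + C) * ((B - 1) / (B + 1)) * (-(C + A - B - 1)) ^ 2 -
      (1 + A + B + C) * ((C - 1) / (C + 1)) * (-(A + B - C - 1)) ^ 2 =
      4 * gramDet A B C ^ 2 / ((A + 1) * (B + 1) * (C + 1)) := by
    unfold gramDet
    field_simp
    ring
  refine (quadratic_form_pos_of_minors_pos (by positivity)
    (lt_of_lt_of_eq (by positivity) minor_two.symm)
    (lt_of_lt_of_eq (by positivity) minor_three.symm) h).trans_eq ?_
  unfold scalingForm
  ring

end Gram

section HyperbolicTriangle

open Real

theorem extHypAngle_eq_zero_or_pi {a b c : ℝ} (h : ¬(a < b + c ∧ b < c + a ∧ c < a + b)) :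
    extHypAngle a b c = 0 ∨ extHypAngle a b c = π := by
  unfold extHypAngle
  split_ifs with ha hbc
  · exact .inr rfl
  · exact .inl rfl
  · push Not at ha hbc
    exact absurd ⟨ha, hbc⟩ h

theorem sinh_mul_tanh_half (x : ℝ) : sinh x * tanh (x / 2) = cosh x - 1 := by
  have hx : x = 2 * (x / 2) := by ring
  have hcosh : cosh (x / 2) ≠ 0 := (cosh_pos _).ne'
  rw [tanh_eq_sinh_div_cosh, hx, sinh_two_mul, cosh_two_mul, cosh_sq, ← hx]
  field_simp
  ring

theorem tanh_half_div_sinh {x : ℝ} (hx : x ≠ 0) : tanh (x / 2) / sinh x = 1 / (cosh x + 1) := by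
  have hsinh : sinh x ≠ 0 := sinh_ne_zero.2 hx
  have hcosh : cosh x + 1 ≠ 0 := by positivity
  rw [div_eq_div_iff hsinh hcosh, one_mul, ← mul_right_inj' hsinh, ← mul_assoc,
    sinh_mul_tanh_half, ← sq, sinh_sq]
  ring

theorem hasDerivAt_two_mul_arsinh_mul_exp {φ : ℝ → ℝ} {φ' t : ℝ} (k : ℝ)
    (hφ : HasDerivAt φ φ' t) :
    HasDerivAt (fun s => 2 * arsinh (k * exp (φ s)))
      (2 * φ' * tanh (arsinh (k * exp (φ t)))) t := by
  refine ((hφ.exp.const_mul k).arsinh.const_mul 2).congr_deriv ?_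
  rw [tanh_arsinh, smul_eq_mul]
  ring

theorem hasDerivAt_hypAngle {a b c : ℝ → ℝ} {t a' b' c' : ℝ} (hb : 0 < b t) (hc : 0 < c t)
    (ha' : HasDerivAt a a' t) (hb' : HasDerivAt b b' t) (hc' : HasDerivAt c c' t)
    (hG : 0 < gramDet (cosh (a t)) (cosh (b t)) (cosh (c t))) :
    HasDerivAt (fun s => hypAngle (a s) (b s) (c s))
      ((sinh (a t) * a' - (cosh (a t) * cosh (b t) - cosh (c t)) / sinh (b t) * b' -
        (cosh (a t) * cosh (c t) - cosh (b t)) / sinh (c t) * c') /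
          √(gramDet (cosh (a t)) (cosh (b t)) (cosh (c t)))) t := by
  have hsb : 0 < sinh (b t) := sinh_pos_iff.2 hb
  have hsc : 0 < sinh (c t) := sinh_pos_iff.2 hc
  have := sqrt_pos.2 hG
  have hcos' := ((hb'.cosh.fun_mul hc'.cosh).fun_sub ha'.cosh).fun_div
    (hb'.sinh.fun_mul hc'.sinh) (mul_pos hsb hsc).ne'
  have sin_sq : 1 - ((cosh (b t) * cosh (c t) - cosh (a t)) / (sinh (b t) * sinh (c t))) ^ 2 =
      gramDet (cosh (a t)) (cosh (b t)) (cosh (c t)) / (sinh (b t) * sinh (c t)) ^ 2 := by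
    rw [gramDet_cosh]
    field_simp
  have hcos : |(cosh (b t) * cosh (c t) - cosh (a t)) / (sinh (b t) * sinh (c t))| < 1 := by
    rw [← sq_lt_one_iff_abs_lt_one, ← sub_pos, sin_sq]
    positivity
  rw [abs_lt] at hcos
  refine ((hasDerivAt_arccos hcos.1.ne' hcos.2.ne).comp t hcos').congr_deriv ?_
  rw [sin_sq, sqrt_div' _ (sq_nonneg _), sqrt_sq (mul_pos hsb hsc).le]
  field_simp
  linear_combination sinh (c t) * cosh (c t) * b' * cosh_sq (b t) +
    sinh (b t) * cosh (b t) * c' * cosh_sq (c t)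

/-- The sides move as under a vertex scaling whose conformal factor has the velocities `h₁`, `h₂`,
`h₃` at the corners opposite to `a`, `b`, `c`. -/
theorem hasDerivAt_hypAngle_pairing {a b c : ℝ → ℝ} {t h₁ h₂ h₃ : ℝ}
    (ha : 0 < a t) (hb : 0 < b t) (hc : 0 < c t)
    (ha' : HasDerivAt a (2 * (h₂ + h₃) * tanh (a t / 2)) t)
    (hb' : HasDerivAt b (2 * (h₃ + h₁) * tanh (b t / 2)) t)
    (hc' : HasDerivAt c (2 * (h₁ + h₂) * tanh (c t / 2)) t)
    (hG : 0 < gramDet (cosh (a t)) (cosh (b t)) (cosh (c t))) :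
    HasDerivAt (fun s => hypAngle (a s) (b s) (c s) * h₁ + hypAngle (b s) (c s) (a s) * h₂ +
        hypAngle (c s) (a s) (b s) * h₃)
      (-(scalingForm (cosh (a t)) (cosh (b t)) (cosh (c t)) (h₂ + h₃) (h₃ + h₁) (h₁ + h₂) /
        √(gramDet (cosh (a t)) (cosh (b t)) (cosh (c t))))) t := by
  have hθ₁ := hasDerivAt_hypAngle hb hc ha' hb' hc' hG
  have hθ₂ := hasDerivAt_hypAngle hc ha hb' hc' ha' (by rwa [gramDet_rotate])
  have hθ₃ := hasDerivAt_hypAngle ha hb hc' ha' hb' (by rwa [gramDet_rotate, gramDet_rotate])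
  refine (((hθ₁.mul_const h₁).fun_add (hθ₂.mul_const h₂)).fun_add
    (hθ₃.mul_const h₃)).congr_deriv ?_
  rw [gramDet_rotate, gramDet_rotate, gramDet_rotate]
  have sinh_mul (x w : ℝ) : sinh x * (2 * w * tanh (x / 2)) = 2 * w * (cosh x - 1) := by
    rw [← sinh_mul_tanh_half]
    ring
  have div_sinh_mul {x : ℝ} (hx : 0 < x) (m w : ℝ) :
      m / sinh x * (2 * w * tanh (x / 2)) = 2 * w * m / (cosh x + 1) := by
    calc m / sinh x * (2 * w * tanh (x / 2)) = 2 * w * m * (tanh (x / 2) / sinh x) := by ring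
      _ = 2 * w * m / (cosh x + 1) := by rw [tanh_half_div_sinh hx.ne', mul_one_div]
  simp only [sinh_mul, div_sinh_mul ha, div_sinh_mul hb, div_sinh_mul hc]
  have hA : cosh (a t) + 1 ≠ 0 := by positivity
  have hB : cosh (b t) + 1 ≠ 0 := by positivity
  have hC : cosh (c t) + 1 ≠ 0 := by positivity
  unfold scalingForm
  field_simp
  ring

end HyperbolicTriangle

namespace Triangulation

variable {S : Type*} [TopologicalSpace S] {V : Finset S}

theorem add_endpoint_side {M : Type*} [AddCommMonoid M] (T : Triangulation S V) (φ : V → M)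
    (f : T.Face) (i : Fin 3) :
    φ (T.endpoint (T.side f i) 0) + φ (T.endpoint (T.side f i) 1) =
      φ (T.corner f (i + 1)) + φ (T.corner f (i + 2)) := by
  obtain ⟨π, hπ⟩ := T.faceMap_side f i
  have corner_eq (j : Fin 2) : T.corner f (i.succAbove j) = T.endpoint (T.side f i) (π j) := by
    have hj := hπ (stdSimplex.vertex j)
    rw [stdSimplex.map_vertex, stdSimplex.map_vertex] at hj
    exact Subtype.ext hj
  have sum_eq : ∑ j, φ (T.endpoint (T.side f i) j) = ∑ j, φ (T.corner f (i.succAbove j)) := by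
    simp_rw [corner_eq]
    exact (Equiv.sum_comp π fun j => φ (T.endpoint (T.side f i) j)).symm
  rw [Fin.sum_univ_two, Fin.sum_univ_two] at sum_eq
  rw [sum_eq]
  fin_cases i
  · rfl
  · exact add_comm _ _
  · rfl

theorem sum_cornerSum_mul (T : Triangulation S V) (θ : T.Face → Fin 3 → ℝ) (φ : V → ℝ) :
    ∑ v, T.cornerSum θ v * φ v = ∑ f, ∑ i, θ f i * φ (T.corner f i) := by
  classical
  simp_rw [cornerSum, Finset.sum_mul]
  rw [Finset.sum_comm]
  refine Finset.sum_congr rfl fun f _ => ?_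
  rw [Finset.sum_comm]
  refine Finset.sum_congr rfl fun i _ => ?_
  simp [ite_mul]

namespace PHMetric

variable {T : Triangulation S V} (d : T.PHMetric)

/-- Strict triangle inequalities in a single face of `u * d`. By definition, `u` is admissible when
every face is nondegenerate. -/
def IsNondegenerateFace (u : V → ℝ) (f : T.Face) : Prop :=
  ∀ i, d.scaledLength u (T.side f i) <
    d.scaledLength u (T.side f (i + 1)) + d.scaledLength u (T.side f (i + 2))

/-- The pairing of the extended angles of `u * d` in a face with a variation `h` of the conformal
factor, by which the face contributes to the pairing of the curvature with `h`. -/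
noncomputable def anglePairing (f : T.Face) (h u : V → ℝ) : ℝ :=
  ∑ i, d.extAngle u f i * h (T.corner f i)

theorem sum_extCurvature_mul (h u : V → ℝ) :
    ∑ v, d.extCurvature u v * h v = 2 * Real.pi * ∑ v, h v - ∑ f, d.anglePairing f h u := by
  simp only [anglePairing, extCurvature, sub_mul, Finset.sum_sub_distrib, ← Finset.mul_sum,
    sum_cornerSum_mul]

theorem continuous_anglePairing (f : T.Face) (h : V → ℝ) : Continuous (d.anglePairing f h) :=
  continuous_finsetSum _ fun i _ => (d.continuous_extAngle f i).mul continuous_const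

theorem anglePairing_eq_hypAngle (f : T.Face) (h u : V → ℝ) :
    d.anglePairing f h u =
      hypAngle (d.scaledLength u (T.side f 0)) (d.scaledLength u (T.side f 1))
        (d.scaledLength u (T.side f 2)) * h (T.corner f 0) +
      hypAngle (d.scaledLength u (T.side f 1)) (d.scaledLength u (T.side f 2))
        (d.scaledLength u (T.side f 0)) * h (T.corner f 1) +
      hypAngle (d.scaledLength u (T.side f 2)) (d.scaledLength u (T.side f 0))
        (d.scaledLength u (T.side f 1)) * h (T.corner f 2) := by
  simp only [anglePairing, extAngle, Fin.sum_univ_three,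
    extHypAngle_eq_hypAngle (d.scaledLength_pos _ _) (d.scaledLength_pos _ _)
      (d.scaledLength_pos _ _)]
  rfl

theorem extAngle_eq_zero_or_pi {u : V → ℝ} {f : T.Face} (hf : ¬d.IsNondegenerateFace u f)
    (i : Fin 3) : d.extAngle u f i = 0 ∨ d.extAngle u f i = Real.pi := by
  refine extHypAngle_eq_zero_or_pi fun ⟨h₀, h₁, h₂⟩ => hf fun j => ?_
  fin_cases i <;> fin_cases j <;> assumption

theorem hasDerivAt_scaledLength (u h : V → ℝ) (e : T.Edge) (t : ℝ) :
    HasDerivAt (fun s : ℝ => d.scaledLength (u + s • h) e)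
      (2 * (h (T.endpoint e 0) + h (T.endpoint e 1)) *
        Real.tanh (d.scaledLength (u + t • h) e / 2)) t := by
  have hφ (v : V) : HasDerivAt (fun s : ℝ => (u + s • h) v) (h v) t := by
    simpa using ((hasDerivAt_id t).mul_const (h v)).const_add (u v)
  simpa only [scaledLength, mul_div_cancel_left₀ _ (two_ne_zero' ℝ)] using
    hasDerivAt_two_mul_arsinh_mul_exp (Real.sinh (d.length e / 2))
      ((hφ (T.endpoint e 0)).fun_add (hφ (T.endpoint e 1)))

theorem exists_hasDerivAt_anglePairing_neg {f : T.Face} {u h : V → ℝ} {t : ℝ}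
    (hf : d.IsNondegenerateFace (u + t • h) f) (hh : ∃ i, h (T.corner f i) ≠ 0) :
    ∃ g' < 0, HasDerivAt (fun s : ℝ => d.anglePairing f h (u + s • h)) g' t := by
  have hlength (i : Fin 3) : HasDerivAt (fun s : ℝ => d.scaledLength (u + s • h) (T.side f i))
      (2 * (h (T.corner f (i + 1)) + h (T.corner f (i + 2))) *
        Real.tanh (d.scaledLength (u + t • h) (T.side f i) / 2)) t := by
    rw [← T.add_endpoint_side]
    exact d.hasDerivAt_scaledLength u h _ t
  have hpos (i : Fin 3) : 0 < d.scaledLength (u + t • h) (T.side f i) := d.scaledLength_pos _ _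
  have hcosh (i : Fin 3) : 1 < Real.cosh (d.scaledLength (u + t • h) (T.side f i)) :=
    Real.one_lt_cosh.2 (hpos i).ne'
  have hG := gramDet_cosh_pos (hf 0) (hf 1) (hf 2)
  have edge_ne : h (T.corner f 1) + h (T.corner f 2) ≠ 0 ∨
      h (T.corner f 2) + h (T.corner f 0) ≠ 0 ∨ h (T.corner f 0) + h (T.corner f 1) ≠ 0 := by
    contrapose! hh
    obtain ⟨h₀, h₁, h₂⟩ := hh
    intro i
    fin_cases i <;> dsimp only [Fin.reduceFinMk, Fin.zero_eta, Fin.mk_one] <;> linarith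
  simp_rw [anglePairing_eq_hypAngle]
  exact ⟨_, neg_neg_of_pos (div_pos (scalingForm_pos (hcosh 0) (hcosh 1) (hcosh 2) hG edge_ne)
    (Real.sqrt_pos.2 hG)), hasDerivAt_hypAngle_pairing (hpos 0) (hpos 1) (hpos 2)
      (hlength 0) (hlength 1) (hlength 2) hG⟩

theorem antitone_anglePairing (f : T.Face) (u h : V → ℝ) :
    Antitone fun s : ℝ => d.anglePairing f h (u + s • h) := by
  by_cases hh : ∃ i, h (T.corner f i) ≠ 0
  · have hfinite : ((fun θ : Fin 3 → ℝ => ∑ i, θ i * h (T.corner f i)) ''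
        Set.univ.pi fun _ => {0, Real.pi}).Finite :=
      (Set.Finite.pi fun _ => Set.toFinite _).image _
    refine antitone_of_hasDerivWithinAt_neg_or_mem
      ((d.continuous_anglePairing f h).comp (by fun_prop)) (hfinite.countable.dense_compl ℝ)
      fun t => ?_
    by_cases hf : d.IsNondegenerateFace (u + t • h) f
    · obtain ⟨g', hg', hd⟩ := d.exists_hasDerivAt_anglePairing_neg hf hh
      exact .inr ⟨g', hg', hd.hasDerivWithinAt⟩
    · exact .inl (Set.mem_image_of_mem _ fun i _ => d.extAngle_eq_zero_or_pi hf i)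
  · push Not at hh
    simpa [anglePairing, hh] using antitone_const

theorem anglePairing_le (f : T.Face) (u u' : V → ℝ) :
    d.anglePairing f (u' - u) u' ≤ d.anglePairing f (u' - u) u := by
  simpa using d.antitone_anglePairing f u (u' - u) zero_le_one

theorem anglePairing_lt {f : T.Face} {u u' : V → ℝ} (hf : d.IsNondegenerateFace u f)
    (h : ∃ i, u' (T.corner f i) ≠ u (T.corner f i)) :
    d.anglePairing f (u' - u) u' < d.anglePairing f (u' - u) u := by
  obtain ⟨g', hg', hd⟩ := d.exists_hasDerivAt_anglePairing_neg (u := u) (h := u' - u) (t := 0)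
    (by simpa using hf) (by simpa [sub_ne_zero] using h)
  simpa using lt_of_antitone_of_hasDerivWithinAt_neg (d.antitone_anglePairing f u (u' - u))
    hd.hasDerivWithinAt hg' one_pos

theorem sum_extCurvature_sub_mul_sub_pos {u u' : V → ℝ} (hu : u ∈ d.admissibleSpace)
    (h : u ≠ u') : 0 < ∑ v, (d.extCurvature u' v - d.extCurvature u v) * (u' v - u v) := by
  have sum_eq : ∑ v, (d.extCurvature u' v - d.extCurvature u v) * (u' v - u v) =
      ∑ f, d.anglePairing f (u' - u) u - ∑ f, d.anglePairing f (u' - u) u' := by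
    have hu' := d.sum_extCurvature_mul (u' - u) u'
    have hu := d.sum_extCurvature_mul (u' - u) u
    simp only [Pi.sub_apply] at hu hu'
    rw [Finset.sum_congr rfl fun v _ => sub_mul _ _ _, Finset.sum_sub_distrib, hu, hu']
    ring
  rw [sum_eq, sub_pos]
  obtain ⟨v, hv⟩ := Function.ne_iff.1 h
  obtain ⟨f, i, hf⟩ := T.exists_corner v v.2
  have hcorner : T.corner f i = v := Subtype.ext hf
  exact Finset.sum_lt_sum (fun f _ => d.anglePairing_le f u u')
    ⟨f, Finset.mem_univ f, d.anglePairing_lt (hu f) ⟨i, hcorner ▸ hv.symm⟩⟩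

theorem extAlphaCurvature_eq_iff {α r : ℝ} {u : V → ℝ} {v : V} :
    d.extAlphaCurvature α u v = r ↔ d.extCurvature u v = r * Real.exp (α * u v) := by
  rw [extAlphaCurvature, ← Real.exp_mul, mul_comm (u v), div_eq_iff (Real.exp_pos _).ne']

theorem alphaCurvature_eq_extAlphaCurvature (α : ℝ) (u : d.admissibleSpace) (v : V) :
    d.alphaCurvature α u v = d.extAlphaCurvature α u v := by
  rw [alphaCurvature, extAlphaCurvature, extCurvature, extAngle_eq_angle, curvature]

theorem eq_of_extAlphaCurvature_eq {α : ℝ} {R : V → ℝ} (hR : ∀ v, α * R v ≤ 0) {u u' : V → ℝ}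
    (hu : u ∈ d.admissibleSpace) (h : ∀ v, d.extAlphaCurvature α u v = R v)
    (h' : ∀ v, d.extAlphaCurvature α u' v = R v) : u = u' := by
  by_contra hne
  refine (d.sum_extCurvature_sub_mul_sub_pos hu hne).not_ge (Finset.sum_nonpos fun v _ => ?_)
  rw [d.extAlphaCurvature_eq_iff.1 (h v), d.extAlphaCurvature_eq_iff.1 (h' v)]
  exact ((antitone_const_mul_exp (hR v)).antivary monotone_id).sub_mul_sub_nonpos (u v) (u' v)

end PHMetric

end Triangulation

theorem mainTheorem3_general {S : Type*} [TopologicalSpace S] (V : Finset S)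
    (T : Triangulation S V) (d₀ : T.PHMetric) (α : ℝ) (R : V → ℝ) (hR : ∀ v, α * R v ≤ 0) :
    {u : d₀.admissibleSpace | ∀ v, d₀.alphaCurvature α u v = R v}.Subsingleton ∧
    ∀ uA ∈ d₀.admissibleSpace, ∀ uB : V → ℝ,
      (∀ v, d₀.extAlphaCurvature α uA v = R v) →
      (∀ v, d₀.extAlphaCurvature α uB v = R v) →
      uA = uB := by
  refine ⟨fun u hu u' hu' => Subtype.ext ?_,
    fun uA hA uB hRA hRB => d₀.eq_of_extAlphaCurvature_eq hR hA hRA hRB⟩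
  simp only [Set.mem_ofPred_eq, d₀.alphaCurvature_eq_extAlphaCurvature] at hu hu'
  exact d₀.eq_of_extAlphaCurvature_eq hR u.2 hu hu'

theorem mainTheorem3 {S : Type*} [TopologicalSpace S] [T2Space S] [CompactSpace S]
    [ConnectedSpace S] [ChartedSpace (EuclideanSpace ℝ (Fin 2)) S]
    (V : Finset S) (T : Triangulation S V) (d₀ : T.PHMetric) (α : ℝ) (R : V → ℝ)
    (hR : ∀ v, α * R v ≤ 0) :
    {u : d₀.admissibleSpace | ∀ v, d₀.alphaCurvature α u v = R v}.Subsingleton ∧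
    ∀ uA ∈ d₀.admissibleSpace, ∀ uB : V → ℝ,
      (∀ v, d₀.extAlphaCurvature α uA v = R v) →
      (∀ v, d₀.extAlphaCurvature α uB v = R v) →
      uA = uB :=
  mainTheorem3_general V T d₀ α R hR
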